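/- Let $k$ be an algebraically closed field of characteristic zero. For a form $F\in k[x_1,x_2,x_3]$ of degree $d$, the Waring rank $\mathrm{rk}(F)$ is the least $s$ such that $F=L_1^d+\dots+L_s^d$ for some linear forms $L_1,\dots,L_s\in k[x_1,x_2,x_3]$. For every integer $d>2$, the maximum $$m(d)=\max\{\mathrm{rk}(M) : M\in k[x_1,x_2,x_3] \text{ is a monomial of degree } d\}$$ exists and $$m(d)=\begin{cases}\left(\frac{d+1}{2}\right)^2 & \text{if } d \text{ is odd},\\[4pt] \frac d2\left(\frac d2+1\right) & \text{if } d \text{ is even,}\end{cases}$$ and it is attained by $x_1x_2^{\lfloor (d-1)/2\rfloor}x_3^{\lceil (d-1)/2\rceil}$. Moreover, for every $d>2$ with $d\neq 4$, the rank of the generic form of degree $d$ in three variables is $g(d)=\left\lceil \frac13\binom{d+2}{2}\right\rceil$, that is, $\mathrm{rk}(F)=g(d)$ for all $F$ in some nonempty Zariski open subset of the space of forms of degree $d$ in $k[x_1,x_2,x_3]$. Asymptotically, $m(d)$ is $\frac32$ times this rank: $$m(d)\sim \frac32\left\lceil \frac13\binom{d+2}{2}\right\rceil\qquad (d\to\infty),$$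 i.e. the quotient of the two sides tends to $1$. -/

import Mathlib

open Filter Asymptotics

/-- `F` is a sum of `s` many `d`-th powers of linear forms (the zero linear form is allowed). -/
def IsSumOfPowers {σ k : Type*} [CommSemiring k] (d s : ℕ) (F : MvPolynomial σ k) : Prop :=
  ∃ L : Fin s → MvPolynomial σ k, (∀ i, (L i).IsHomogeneous 1) ∧ F = ∑ i, L i ^ d

/-- The Waring rank of a form `F` of degree `d`: the least `s` such that `F` is a sum of `s` many
`d`-th powers of linear forms. It takes values in `ℕ∞`, so that the rank is `⊤` when there is no
such expression at all. -/
noncomputable def waringRank {σ k : Type*} [CommSemiring k] (d : ℕ) (F : MvPolynomial σ k) : ℕ∞ :=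
  sInf ((fun s : ℕ => (s : ℕ∞)) '' {s : ℕ | IsSumOfPowers d s F})

/-- The Waring ranks of all the monomials of degree `d` in three variables over `k`. -/
def ternaryMonomialRanks (k : Type*) [CommSemiring k] (d : ℕ) : Set ℕ∞ :=
  {r | ∃ a : Fin 3 →₀ ℕ, a.degree = d ∧ waringRank d (MvPolynomial.monomial a (1 : k)) = r}

/-- The generic ternary form of degree `d` over `k` has Waring rank `r`: the rank is `r` on a
nonempty Zariski open subset of the vector space of ternary forms of degree `d`. Here the open set
is a principal one, given by the non-vanishing of a polynomial `Φ` in the coefficients of the form;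
as principal open sets are a basis of the Zariski topology this is no restriction. -/
def IsGenericTernaryRank (k : Type*) [CommSemiring k] (d r : ℕ) : Prop :=
  ∃ Φ : MvPolynomial (Fin 3 →₀ ℕ) k,
    (∃ F : MvPolynomial (Fin 3) k, F.IsHomogeneous d ∧
      MvPolynomial.eval (fun a => F.coeff a) Φ ≠ 0) ∧
    ∀ F : MvPolynomial (Fin 3) k, F.IsHomogeneous d →
      MvPolynomial.eval (fun a => F.coeff a) Φ ≠ 0 → waringRank d F = r

/-! ### Degeneration of interpolation problems for Laurent polynomials. -/

section Planar

/-! Comparing coefficients turns a decomposition into `s` powers of linear forms into a moment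
problem for `s` points of `k³` (`isSumOfPowers_iff`).

Monomials. For a monomial with smallest exponent `a₀`, orthogonality of roots of unity gives an
explicit sum of `(a₁+1)(a₂+1)` powers; if `a₀ = 0`, the bound `d+1` for binary forms is used
instead. When `a₀ = 1` fewer points are impossible: some nonzero polynomial with exponents in the
box `[0,a₁] × [0,a₂]` would vanish at all of them, and its leading term would kill the one nonzero
moment (`le_of_isSumOfPowers_monomial`). If `a₀ ≥ 1` then `a₁ + a₂ ≤ d - 1`, so `(a₁+1)(a₂+1)` is
largest when `a₀ = 1` and the other two exponents are balanced.

Generic forms. With `N = (d+2).choose 2` coefficients, fewer than `N/3` powers cannot suffice, by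
transcendence degree. For the converse, the power sum map is dominant as soon as its Jacobian has
full rank at one point (`algebraicIndependent_of_jacobian`, `exists_forall_eval_ne_zero`). By
Terracini this says that no nonzero polynomial of degree at most `d` is singular at `s` suitable
points of the torus. Such points are found by toric degeneration: if the lattice triangle of
exponents is cut successively by lines into noncollinear triples and at most one single point, one
torus point per piece suffices (`NonSpecial.union`). These cuttings are built by induction on `d`
from diagonal strips (`exists_nonSpecial_triangle`).

Both ranks are quadratic in `d`, with leading coefficients `1/4` and `1/6`, whence the factor `3/2`.
-/

theorem Matrix.exists_mul_eq_one_of_mulVec_injective {m n k : Type*} [Field k] [Fintype m]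
    [Fintype n] [DecidableEq m] [DecidableEq n] (M : Matrix m n k)
    (hM : ∀ v, M.mulVec v = 0 → v = 0) : ∃ L : Matrix n m k, L * M = 1 := by
  obtain ⟨g, hg⟩ := (Matrix.toLin' M).exists_leftInverse_of_injective
    (LinearMap.ker_eq_bot'.2 fun v hv => hM v (by simpa using hv))
  refine ⟨LinearMap.toMatrix' g, ?_⟩
  rw [← LinearMap.toMatrix'_toLin' M, ← LinearMap.toMatrix'_comp, hg, LinearMap.toMatrix'_id]

/-- Full column rank is an open condition: with a left inverse `L` at `0`, the polynomial `det (L *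
M)` takes the value `1` at `0`, hence is nonzero at some other parameter. -/
theorem Matrix.exists_ne_zero_mulVec_injective {m n k : Type*} [Field k] [Infinite k] [Fintype m]
    [Fintype n] [DecidableEq m] [DecidableEq n] (M : Matrix m n (Polynomial k))
    (hM : ∀ v, (M.map (Polynomial.eval 0)).mulVec v = 0 → v = 0) :
    ∃ t : k, t ≠ 0 ∧ ∀ v, (M.map (Polynomial.eval t)).mulVec v = 0 → v = 0 := by
  obtain ⟨L, hL⟩ := Matrix.exists_mul_eq_one_of_mulVec_injective _ hM
  set D : Polynomial k := (L.map Polynomial.C * M).det with hD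
  have heval : ∀ t, D.eval t = (L * M.map (Polynomial.eval t)).det := by
    intro t
    rw [hD, ← Polynomial.coe_evalRingHom, RingHom.map_det, RingHom.mapMatrix_apply,
      Matrix.map_mul, Matrix.map_map]
    congr 2
    ext i j
    simp
  -- The extra factor `X` forces the parameter found to be nonzero.
  have hD0 : D * Polynomial.X ≠ 0 := by
    refine mul_ne_zero (fun h => ?_) Polynomial.X_ne_zero
    have := heval 0
    rw [h, hL] at this
    simp at this
  obtain ⟨t, ht⟩ : ∃ t, (D * Polynomial.X).eval t ≠ 0 := by
    by_contra! h
    exact hD0 (Polynomial.funext fun t => by simpa using h t)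
  rw [Polynomial.eval_mul, Polynomial.eval_X, heval] at ht
  refine ⟨t, right_ne_zero_of_mul ht, fun v hv => ?_⟩
  refine Matrix.eq_zero_of_mulVec_eq_zero (left_ne_zero_of_mul ht) ?_
  rw [← Matrix.mulVec_mulVec, hv, Matrix.mulVec_zero]

/-- The evaluation at `p` of the `m`-th logarithmic derivative (`m = 0` being the identity) of the
Laurent monomial with exponent `a`. -/
def logDeriv₃ {k : Type*} [Field k] (p : k × k) (a : ℤ × ℤ) (m : Fin 3) : k :=
  p.1 ^ a.1 * p.2 ^ a.2 * ![1, (a.1 : k), (a.2 : k)] m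

/-- There are `s` points of the torus such that no nonzero Laurent polynomial supported in `A` is
singular at all of them. -/
def NonSpecial (k : Type*) [Field k] (A : Finset (ℤ × ℤ)) (s : ℕ) : Prop :=
  ∃ p : Fin s → k × k, (∀ i, (p i).1 ≠ 0 ∧ (p i).2 ≠ 0) ∧
    ∀ f : ℤ × ℤ → k, (∀ i m, ∑ a ∈ A, f a * logDeriv₃ (p i) a m = 0) → ∀ a ∈ A, f a = 0

variable {k : Type*} [Field k]

theorem NonSpecial.singleton (a : ℤ × ℤ) : NonSpecial k {a} 1 := by
  refine ⟨fun _ => (1, 1), by simp, fun f hf b hb => ?_⟩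
  have := hf 0 0
  simp only [Finset.mem_singleton] at hb
  simpa [logDeriv₃, hb] using this

/-- At the point `(1, 1)` the three conditions form a `3 × 3` system whose determinant is twice the
signed area of the triangle `a b c`; Cramer's rule solves it. -/
theorem NonSpecial.triple [CharZero k] (a b c : ℤ × ℤ)
    (h : (b.1 - a.1) * (c.2 - a.2) - (c.1 - a.1) * (b.2 - a.2) ≠ 0) :
    NonSpecial k {a, b, c} 1 := by
  have hab : a ≠ b := by rintro rfl; simp at h
  have hac : a ≠ c := by rintro rfl; simp at h
  have hbc : b ≠ c := by rintro rfl; apply h; ring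
  have h' : ((b.1 : k) - a.1) * (c.2 - a.2) - (c.1 - a.1) * (b.2 - a.2) ≠ 0 := by
    exact_mod_cast h
  refine ⟨fun _ => (1, 1), by simp, fun f hf => ?_⟩
  have h0 := hf 0 0
  have h1 := hf 0 1
  have h2 := hf 0 2
  rw [Finset.sum_insert (by simp [hab, hac]), Finset.sum_pair hbc] at h0 h1 h2
  simp [logDeriv₃] at h0 h1 h2
  have ha : f a = 0 := by
    refine (mul_eq_zero.1 (?_ : f a * _ = 0)).resolve_right h'
    linear_combination ((b.1 : k) * c.2 - c.1 * b.2) * h0 + ((b.2 : k) - c.2) * h1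
      + ((c.1 : k) - b.1) * h2
  have hb : f b = 0 := by
    refine (mul_eq_zero.1 (?_ : f b * _ = 0)).resolve_right h'
    linear_combination ((c.1 : k) * a.2 - a.1 * c.2) * h0 + ((c.2 : k) - a.2) * h1
      + ((a.1 : k) - c.1) * h2
  have hc : f c = 0 := by simpa [ha, hb] using h0
  simp [ha, hb, hc]

/-- Multiplication by a Laurent monomial is invertible on the torus and preserves singular points:
each logarithmic derivative changes only by a multiple of the value. -/
theorem NonSpecial.translate {A : Finset (ℤ × ℤ)} {s : ℕ} (h : NonSpecial k A s) (v : ℤ × ℤ) :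
    NonSpecial k (A.map (Equiv.addRight v).toEmbedding) s := by
  obtain ⟨p, hp, H⟩ := h
  refine ⟨p, hp, fun f hf => ?_⟩
  have := H (fun a => f (a + v)) fun i => by
    have key : ∀ m, ∑ a ∈ A, f (a + v) * logDeriv₃ (p i) (a + v) m = 0 := by
      intro m; simpa using hf i m
    have hv : (p i).1 ^ v.1 * (p i).2 ^ v.2 ≠ 0 :=
      mul_ne_zero (zpow_ne_zero _ (hp i).1) (zpow_ne_zero _ (hp i).2)
    have e : ∀ a, (p i).1 ^ (a + v).1 * (p i).2 ^ (a + v).2 =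
        (p i).1 ^ v.1 * (p i).2 ^ v.2 * ((p i).1 ^ a.1 * (p i).2 ^ a.2) := by
      intro a
      rw [Prod.fst_add, Prod.snd_add, zpow_add₀ (hp i).1, zpow_add₀ (hp i).2]; ring
    have h0 : ∑ a ∈ A, f (a + v) * ((p i).1 ^ a.1 * (p i).2 ^ a.2) = 0 := by
      refine (mul_eq_zero.1 (?_ : ((p i).1 ^ v.1 * (p i).2 ^ v.2) * _ = 0)).resolve_left hv
      rw [← key 0, Finset.mul_sum]
      refine Finset.sum_congr rfl fun a _ => ?_
      simp only [logDeriv₃, e]; simp; ring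
    have h1 : ∑ a ∈ A, f (a + v) * ((p i).1 ^ a.1 * (p i).2 ^ a.2 * a.1) = 0 := by
      refine (mul_eq_zero.1 (?_ : ((p i).1 ^ v.1 * (p i).2 ^ v.2) * _ = 0)).resolve_left hv
      have e1 : ∑ a ∈ A, f (a + v) * logDeriv₃ (p i) (a + v) 1 =
          (p i).1 ^ v.1 * (p i).2 ^ v.2 *
            ∑ a ∈ A, f (a + v) * ((p i).1 ^ a.1 * (p i).2 ^ a.2 * a.1) +
          (p i).1 ^ v.1 * (p i).2 ^ v.2 * v.1 *
            ∑ a ∈ A, f (a + v) * ((p i).1 ^ a.1 * (p i).2 ^ a.2) := by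
        rw [Finset.mul_sum, Finset.mul_sum, ← Finset.sum_add_distrib]
        refine Finset.sum_congr rfl fun a _ => ?_
        simp only [logDeriv₃, e]; simp; ring
      rwa [key, h0, mul_zero, add_zero, eq_comm] at e1
    have h2 : ∑ a ∈ A, f (a + v) * ((p i).1 ^ a.1 * (p i).2 ^ a.2 * a.2) = 0 := by
      refine (mul_eq_zero.1 (?_ : ((p i).1 ^ v.1 * (p i).2 ^ v.2) * _ = 0)).resolve_left hv
      have e2 : ∑ a ∈ A, f (a + v) * logDeriv₃ (p i) (a + v) 2 =
          (p i).1 ^ v.1 * (p i).2 ^ v.2 *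
            ∑ a ∈ A, f (a + v) * ((p i).1 ^ a.1 * (p i).2 ^ a.2 * a.2) +
          (p i).1 ^ v.1 * (p i).2 ^ v.2 * v.2 *
            ∑ a ∈ A, f (a + v) * ((p i).1 ^ a.1 * (p i).2 ^ a.2) := by
        rw [Finset.mul_sum, Finset.mul_sum, ← Finset.sum_add_distrib]
        refine Finset.sum_congr rfl fun a _ => ?_
        simp only [logDeriv₃, e]; simp; ring
      rwa [key, h0, mul_zero, add_zero, eq_comm] at e2
    intro m
    fin_cases m
    · simpa [logDeriv₃] using h0
    · simpa [logDeriv₃] using h1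
    · simpa [logDeriv₃] using h2
  intro a ha
  simp only [Finset.mem_map, Equiv.coe_toEmbedding, Equiv.coe_addRight] at ha
  obtain ⟨b, hb, rfl⟩ := ha
  exact this b hb

/-- Degeneration along a linear functional separating `B` from `C`. -/
theorem NonSpecial.union [Infinite k] {B C : Finset (ℤ × ℤ)} {s t : ℕ} (u v c : ℤ)
    (hB : NonSpecial k B s) (hC : NonSpecial k C t)
    (hBc : ∀ a ∈ B, u * a.1 + v * a.2 < c) (hCc : ∀ a ∈ C, c ≤ u * a.1 + v * a.2) :
    NonSpecial k (B ∪ C) (s + t) := by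
  obtain ⟨p, hp, HB⟩ := hB
  obtain ⟨q, hq, HC⟩ := hC
  have hdisj : Disjoint B C := Finset.disjoint_left.2 fun a hb hc => by
    have := hBc a hb; have := hCc a hc; omega
  set w : ℤ × ℤ → ℤ := fun a => u * a.1 + v * a.2 with hw
  -- At `X = 0` this is block triangular: the rows of `q` see only `C`, while those of `p` see all
  -- of `B`. So a kernel vector vanishes first on `C`, then on `B`.
  let M : Matrix ((Fin s ⊕ Fin t) × Fin 3) (B ∪ C : Finset (ℤ × ℤ)) (Polynomial k) := fun r a =>
    match r.1 with
    | .inl i => Polynomial.C (logDeriv₃ (p i) a r.2) * Polynomial.X ^ (w a - c).toNat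
    | .inr j => Polynomial.C (logDeriv₃ (q j) a r.2) * Polynomial.X ^ (c - w a).toNat
  have row_inl : ∀ (x : k) (g : (B ∪ C : Finset (ℤ × ℤ)) → k) (G : ℤ × ℤ → k)
      (_ : ∀ a, g a = G a) i m, (M.map (Polynomial.eval x)).mulVec g (.inl i, m) =
        ∑ a ∈ B ∪ C, G a * (logDeriv₃ (p i) a m * x ^ (w a - c).toNat) := by
    intro x g G hG i m
    rw [← Finset.sum_coe_sort (B ∪ C)]
    refine Finset.sum_congr rfl fun a _ => ?_
    change (M (.inl i, m) a).eval x * g a = _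
    rw [hG, mul_comm]
    simp [M]
  have row_inr : ∀ (x : k) (g : (B ∪ C : Finset (ℤ × ℤ)) → k) (G : ℤ × ℤ → k)
      (_ : ∀ a, g a = G a) j m, (M.map (Polynomial.eval x)).mulVec g (.inr j, m) =
        ∑ a ∈ B ∪ C, G a * (logDeriv₃ (q j) a m * x ^ (c - w a).toNat) := by
    intro x g G hG i m
    rw [← Finset.sum_coe_sort (B ∪ C)]
    refine Finset.sum_congr rfl fun a _ => ?_
    change (M (.inr i, m) a).eval x * g a = _
    rw [hG, mul_comm]
    simp [M]
  obtain ⟨x, hx, H⟩ := Matrix.exists_ne_zero_mulVec_injective M (by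
    intro g hg
    let G : ℤ × ℤ → k := fun a => if h : a ∈ B ∪ C then g ⟨a, h⟩ else 0
    have hG : ∀ a, g a = G a := fun a => by simp only [G, dif_pos a.2]
    have hGC : ∀ a ∈ C, G a = 0 := by
      refine HC G fun j m => ?_
      have := congrFun hg (.inr j, m)
      rw [row_inr 0 g G hG, Finset.sum_union hdisj, Finset.sum_eq_zero, zero_add] at this
      · rw [← Pi.zero_apply (M := fun _ => k), ← this]
        refine Finset.sum_congr rfl fun a ha => ?_
        rw [Int.toNat_eq_zero.2 (by have := hCc a ha; simp only [hw]; omega), pow_zero, mul_one]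
      · intro a ha
        rw [zero_pow, mul_zero, mul_zero]
        have := hBc a ha
        simp only [hw]; omega
    have hGB : ∀ a ∈ B, G a = 0 := by
      refine HB G fun i m => ?_
      have := congrFun hg (.inl i, m)
      rw [row_inl 0 g G hG, Finset.sum_union hdisj, add_comm, Finset.sum_eq_zero, zero_add] at this
      · rw [← Pi.zero_apply (M := fun _ => k), ← this]
        refine Finset.sum_congr rfl fun a ha => ?_
        rw [Int.toNat_eq_zero.2 (by have := hBc a ha; simp only [hw]; omega), pow_zero, mul_one]
      · intro a ha
        rw [hGC a ha, zero_mul]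
    ext a
    rw [hG]
    rcases Finset.mem_union.1 a.2 with h | h
    exacts [hGB _ h, hGC _ h])
  -- Moving `q` along the one-parameter subgroup `(-u, -v)` multiplies the monomial `a` by `x ^ (-w
  -- a)`. Up to the row factor `x ^ c` and a rescaling of the unknowns this gives the matrix `M` at
  -- `x`.
  refine ⟨Fin.append p fun j => ((q j).1 * x ^ (-u), (q j).2 * x ^ (-v)), fun i => ?_, fun f hf => ?_⟩
  · refine Fin.addCases (fun i => ?_) (fun j => ?_) i
    · simpa using hp i
    · simpa [hx, zpow_ne_zero] using hq j
  have key := H (fun a => f a * (x ^ (w a - c).toNat)⁻¹) (by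
    ext ⟨i | j, m⟩
    · rw [row_inl x _ (fun a => f a * (x ^ (w a - c).toNat)⁻¹) (fun _ => rfl)]
      have := hf (Fin.castAdd t i) m
      rw [Fin.append_left] at this
      rw [Pi.zero_apply, ← this]
      refine Finset.sum_congr rfl fun a _ => ?_
      field_simp
    · rw [row_inr x _ (fun a => f a * (x ^ (w a - c).toNat)⁻¹) (fun _ => rfl)]
      have := hf (Fin.natAdd s j) m
      rw [Fin.append_right] at this
      rw [Pi.zero_apply, ← mul_zero (x ^ c), ← this, Finset.mul_sum]
      refine Finset.sum_congr rfl fun a _ => ?_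
      have h1 : x ^ c * ((x ^ (-u)) ^ a.1 * (x ^ (-v)) ^ a.2) =
          (x ^ (w a - c).toNat)⁻¹ * x ^ (c - w a).toNat := by
        rw [← zpow_natCast, ← zpow_natCast, ← zpow_neg, ← zpow_mul, ← zpow_mul,
          ← zpow_add₀ hx, ← zpow_add₀ hx, ← zpow_add₀ hx]
        congr 1
        simp only [hw, neg_mul]
        omega
      simp only [logDeriv₃, mul_zpow]
      linear_combination (-f a * (q j).1 ^ a.1 * (q j).2 ^ a.2 * ![1, (a.1 : k), (a.2 : k)] m) * h1)
  intro a ha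
  have := congrFun key ⟨a, ha⟩
  simpa [hx] using this

end Planar

/-! ### Cutting the lattice triangles into noncollinear triples. -/

section Triangles

/-- The lattice points of the half-plane strip `lo ≤ x + y ≤ hi` with `x₀ ≤ x` and `0 ≤ y`. -/
noncomputable def diagStrip (lo hi x₀ : ℤ) : Finset (ℤ × ℤ) :=
  (Finset.Icc x₀ hi ×ˢ Finset.Icc 0 (hi - x₀)).filter fun a => lo ≤ a.1 + a.2 ∧ a.1 + a.2 ≤ hi

theorem mem_diagStrip {lo hi x₀ : ℤ} {a : ℤ × ℤ} :
    a ∈ diagStrip lo hi x₀ ↔ x₀ ≤ a.1 ∧ 0 ≤ a.2 ∧ lo ≤ a.1 + a.2 ∧ a.1 + a.2 ≤ hi := by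
  simp only [diagStrip, Finset.mem_filter, Finset.mem_product, Finset.mem_Icc]
  omega

theorem mem_map_addRight {A : Finset (ℤ × ℤ)} {v a : ℤ × ℤ} :
    a ∈ A.map (Equiv.addRight v).toEmbedding ↔ a - v ∈ A := by
  rw [Finset.mem_map_equiv]
  simp [sub_eq_add_neg]

variable {k : Type*} [Field k] [CharZero k]

/-- An explicit certificate: each `union` gives a linear functional and a threshold separating one
piece from all the remaining ones. The other base cases have the same form. -/
theorem nonSpecial_cubics : NonSpecial k (diagStrip 0 3 0) 4 := by
  have h : NonSpecial k _ 4 :=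
    NonSpecial.union 0 (-1) (-2) (.singleton (0, 3))
    (.union 1 (-1) 0 (.triple (0, 1) (0, 2) (1, 2) (by decide))
    (.union (-1) 0 (-1) (.triple (2, 0) (2, 1) (3, 0) (by decide))
    (.triple (0, 0) (1, 0) (1, 1) (by decide)) (by decide) (by decide))
    (by decide) (by decide))
    (by decide) (by decide)
  convert h using 1
  decide +kernel

theorem nonSpecial_sextics : NonSpecial k (diagStrip 0 6 0) 10 := by
  have h : NonSpecial k _ 10 :=
    NonSpecial.union 0 (-1) (-4) (.triple (0, 5) (0, 6) (1, 5) (by decide))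
    (.union 1 1 1 (.singleton (0, 0))
    (.union 2 1 3 (.triple (0, 1) (0, 2) (1, 0) (by decide))
    (.union 1 (-1) (-2) (.triple (0, 3) (0, 4) (1, 4) (by decide))
    (.union 2 (-1) 1 (.triple (1, 2) (1, 3) (2, 4) (by decide))
    (.union 2 1 6 (.triple (1, 1) (2, 0) (2, 1) (by decide))
    (.union (-1) (-2) (-7) (.triple (2, 3) (3, 3) (4, 2) (by decide))
    (.union 2 3 10 (.triple (3, 0) (3, 1) (4, 0) (by decide))
    (.union 1 0 5 (.triple (2, 2) (3, 2) (4, 1) (by decide))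
    (.triple (5, 0) (5, 1) (6, 0) (by decide)) (by decide) (by decide))
    (by decide) (by decide))
    (by decide) (by decide))
    (by decide) (by decide))
    (by decide) (by decide))
    (by decide) (by decide))
    (by decide) (by decide))
    (by decide) (by decide))
    (by decide) (by decide)
  convert h using 1
  decide +kernel

theorem nonSpecial_octics : NonSpecial k (diagStrip 0 8 0) 15 := by
  have h : NonSpecial k _ 15 :=
    NonSpecial.union (-1) 0 (-6) (.triple (7, 0) (7, 1) (8, 0) (by decide))
    (.union (-2) (-1) (-12) (.triple (5, 3) (6, 1) (6, 2) (by decide))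
    (.union 0 (-1) (-6) (.triple (0, 7) (0, 8) (1, 7) (by decide))
    (.union (-3) (-2) (-18) (.triple (3, 5) (4, 4) (5, 2) (by decide))
    (.union (-2) (-1) (-10) (.triple (4, 3) (5, 1) (6, 0) (by decide))
    (.union (-2) (-3) (-18) (.triple (1, 6) (2, 5) (2, 6) (by decide))
    (.union 1 1 2 (.triple (0, 0) (0, 1) (1, 0) (by decide))
    (.union (-4) (-3) (-20) (.triple (3, 3) (3, 4) (4, 2) (by decide))
    (.union (-1) 0 (-3) (.triple (4, 0) (4, 1) (5, 0) (by decide))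
    (.union (-3) (-2) (-12) (.triple (1, 5) (2, 4) (3, 2) (by decide))
    (.union 1 2 4 (.triple (1, 1) (2, 0) (3, 0) (by decide))
    (.union (-4) (-3) (-15) (.triple (0, 6) (1, 4) (2, 3) (by decide))
    (.union 2 3 9 (.triple (0, 2) (1, 2) (2, 1) (by decide))
    (.union 3 2 10 (.triple (0, 3) (0, 4) (1, 3) (by decide))
    (.triple (0, 5) (2, 2) (3, 1) (by decide)) (by decide) (by decide))
    (by decide) (by decide))
    (by decide) (by decide))
    (by decide) (by decide))
    (by decide) (by decide))
    (by decide) (by decide))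
    (by decide) (by decide))
    (by decide) (by decide))
    (by decide) (by decide))
    (by decide) (by decide))
    (by decide) (by decide))
    (by decide) (by decide))
    (by decide) (by decide))
    (by decide) (by decide)
  convert h using 1
  decide +kernel

theorem nonSpecial_quintics_strip : NonSpecial k (diagStrip 2 5 0) 6 := by
  have h : NonSpecial k _ 6 :=
    NonSpecial.union (-1) 0 (-3) (.triple (4, 0) (4, 1) (5, 0) (by decide))
    (.union 0 (-1) (-3) (.triple (0, 4) (0, 5) (1, 4) (by decide))
    (.union 1 (-1) (-1) (.triple (0, 2) (0, 3) (1, 3) (by decide))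
    (.union (-1) (-2) (-5) (.triple (2, 2) (2, 3) (3, 2) (by decide))
    (.union 2 1 5 (.triple (1, 1) (1, 2) (2, 0) (by decide))
    (.triple (2, 1) (3, 0) (3, 1) (by decide)) (by decide) (by decide))
    (by decide) (by decide))
    (by decide) (by decide))
    (by decide) (by decide))
    (by decide) (by decide)
  convert h using 1
  decide +kernel

theorem nonSpecial_parallelogram₂ (x y : ℤ) :
    NonSpecial k ((diagStrip 2 3 0 \ diagStrip 2 3 3).map
      (Equiv.addRight ((x, y) : ℤ × ℤ)).toEmbedding) 2 := by
  refine NonSpecial.translate ?_ _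
  have h : NonSpecial k _ 2 := NonSpecial.union 1 (-1) 0
    (.triple (0, 2) (0, 3) (1, 2) (by decide)) (.triple (1, 1) (2, 0) (2, 1) (by decide))
    (by decide) (by decide)
  convert h using 1
  decide +kernel

omit [CharZero k] in
theorem NonSpecial.congr {lo hi lo' hi' x₀ : ℤ} {s s' : ℕ}
    (H : NonSpecial k (diagStrip lo hi x₀) s) (h₁ : lo = lo') (h₂ : hi = hi') (h₃ : s = s') :
    NonSpecial k (diagStrip lo' hi' x₀) s' := by
  subst h₁ h₂ h₃
  exact H

/-- The three leftmost columns are split off. Since `x₀ + 2 ≤ lo`, the condition `0 ≤ y` does not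
cut them, so they form a translate of the six-point parallelogram. -/
theorem NonSpecial.extend_strip₂ {lo x₀ : ℤ} {s : ℕ} (h : x₀ + 2 ≤ lo)
    (H : NonSpecial k (diagStrip lo (lo + 1) (x₀ + 3)) s) :
    NonSpecial k (diagStrip lo (lo + 1) x₀) (2 + s) := by
  convert (nonSpecial_parallelogram₂ (k := k) x₀ (lo - x₀ - 2)).union 1 0 (x₀ + 3) H ?_ ?_ using 1
  · ext ⟨x, y⟩
    simp only [Finset.mem_union, mem_map_addRight, Finset.mem_sdiff, mem_diagStrip, Prod.fst_sub,
      Prod.snd_sub]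
    omega
  · rintro ⟨x, y⟩
    simp only [mem_map_addRight, Finset.mem_sdiff, mem_diagStrip, Prod.fst_sub, Prod.snd_sub]
    omega
  · rintro ⟨x, y⟩
    simp only [mem_diagStrip]
    omega

theorem nonSpecial_parallelogram₄ (x y : ℤ) :
    NonSpecial k ((diagStrip 2 5 0 \ diagStrip 2 5 3).map
      (Equiv.addRight ((x, y) : ℤ × ℤ)).toEmbedding) 4 := by
  convert (nonSpecial_parallelogram₂ (k := k) x y).union 1 1 (x + y + 4)
    (nonSpecial_parallelogram₂ (k := k) x (y + 2)) ?_ ?_ using 1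
  · ext ⟨x, y⟩
    simp only [Finset.mem_union, mem_map_addRight, Finset.mem_sdiff, mem_diagStrip, Prod.fst_sub,
      Prod.snd_sub]
    omega
  all_goals
    rintro ⟨x, y⟩
    simp only [mem_map_addRight, Finset.mem_sdiff, mem_diagStrip, Prod.fst_sub, Prod.snd_sub]
    omega

theorem NonSpecial.extend_strip₄ {lo x₀ : ℤ} {s : ℕ} (h : x₀ + 2 ≤ lo)
    (H : NonSpecial k (diagStrip lo (lo + 3) (x₀ + 3)) s) :
    NonSpecial k (diagStrip lo (lo + 3) x₀) (4 + s) := by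
  convert (nonSpecial_parallelogram₄ (k := k) x₀ (lo - x₀ - 2)).union 1 0 (x₀ + 3) H ?_ ?_ using 1
  · ext ⟨x, y⟩
    simp only [Finset.mem_union, mem_map_addRight, Finset.mem_sdiff, mem_diagStrip, Prod.fst_sub,
      Prod.snd_sub]
    omega
  · rintro ⟨x, y⟩
    simp only [mem_map_addRight, Finset.mem_sdiff, mem_diagStrip, Prod.fst_sub, Prod.snd_sub]
    omega
  · rintro ⟨x, y⟩
    simp only [mem_diagStrip]
    omega

omit [CharZero k] in
theorem NonSpecial.shift {lo hi : ℤ} {s : ℕ} (H : NonSpecial k (diagStrip lo hi 0) s) (x₀ : ℤ) :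
    NonSpecial k (diagStrip (x₀ + lo) (x₀ + hi) x₀) s := by
  convert H.translate (x₀, 0) using 1
  ext ⟨x, y⟩
  simp only [mem_map_addRight, mem_diagStrip, Prod.fst_sub, Prod.snd_sub]
  omega

theorem nonSpecial_strip₂ (n : ℕ) (x₀ : ℤ) :
    NonSpecial k (diagStrip (x₀ + 3 * n) (x₀ + 3 * n + 1) x₀) (2 * n + 1) := by
  induction n generalizing x₀ with
  | zero =>
    have h : NonSpecial k (diagStrip 0 1 0) 1 := by
      convert NonSpecial.triple (k := k) (0, 0) (0, 1) (1, 0) (by decide) using 1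
      decide +kernel
    simpa using h.shift x₀
  | succ n ih =>
    have := NonSpecial.extend_strip₂ (x₀ := x₀) (by omega) (ih (x₀ + 3))
    exact this.congr (by push_cast; ring) (by push_cast; ring) (by ring)

/-- Removing `n` parallelograms of twelve points, four triples each, leaves a translate of the short
strip that starts at level `c`. -/
theorem nonSpecial_strip₄ {c : ℤ} {s : ℕ} (hc : 0 ≤ c)
    (H : NonSpecial k (diagStrip c (c + 3) 0) s) (n : ℕ) (x₀ : ℤ) :
    NonSpecial k (diagStrip (x₀ + 3 * n + c) (x₀ + 3 * n + c + 3) x₀) (4 * n + s) := by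
  induction n generalizing x₀ with
  | zero => simpa [add_assoc] using H.shift x₀
  | succ n ih =>
    have := NonSpecial.extend_strip₄ (x₀ := x₀) (by omega) (ih (x₀ + 3))
    exact this.congr (by push_cast; ring) (by push_cast; ring) (by ring)

theorem NonSpecial.stack {m m' d : ℤ} {s t : ℕ} (hm' : m' = m + 1) (hm : 0 ≤ m) (hmd : m ≤ d)
    (H : NonSpecial k (diagStrip 0 m 0) s)
    (H' : NonSpecial k (diagStrip m' d 0) t) : NonSpecial k (diagStrip 0 d 0) (s + t) := by
  convert H.union 1 1 m' H' ?_ ?_ using 1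
  · ext ⟨x, y⟩
    simp only [Finset.mem_union, mem_diagStrip]
    omega
  all_goals
    rintro ⟨x, y⟩
    simp only [mem_diagStrip]
    omega

theorem exists_nonSpecial_two_mod_three (n : ℕ) :
    ∃ s : ℕ, 6 * s = (3 * n + 6) * (3 * n + 7) ∧
      NonSpecial k (diagStrip 0 (3 * n + 5) 0) s := by
  induction n using Nat.twoStepInduction with
  | zero =>
    refine ⟨7, by norm_num, ?_⟩
    have h := NonSpecial.stack (by norm_num) (by norm_num) (by norm_num)
      (nonSpecial_strip₂ (k := k) 0 0) (nonSpecial_quintics_strip (k := k))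
    simpa using h
  | one => exact ⟨15, by norm_num, nonSpecial_octics⟩
  -- The degree grows by `6`: a strip of two diagonals brings it from `3n+5` to `3n+7`, and one of
  -- four diagonals to `3n+11`.
  | more n ih _ =>
    obtain ⟨s, hs, H⟩ := ih
    refine ⟨s + (2 * (n + 2 : ℕ) + 1) + (4 * (n + 2 : ℕ) + 6), by linarith, ?_⟩
    refine NonSpecial.stack (m := 3 * n + 7) (m' := 3 * n + 8) (by ring) (by omega)
      (by push_cast; omega)
      (NonSpecial.stack (m' := 3 * n + 6) (by ring) (by omega) (by omega) H ?_) ?_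
    · exact (nonSpecial_strip₂ (k := k) (n + 2) 0).congr (by push_cast; ring) (by push_cast; ring) rfl
    · exact (nonSpecial_strip₄ (k := k) (by norm_num) nonSpecial_quintics_strip (n + 2) 0).congr (by push_cast; ring) (by push_cast; ring) rfl

/-- The bound on `s` says that `s` is at most a third of the number of lattice points, rounded up.
Degrees `0` and `1` modulo `3` come from degree `2` modulo `3` by adding a strip of four or two
diagonals; degrees `3` and `6` are too small for this. -/
theorem exists_nonSpecial_triangle {d : ℕ} (hd : 2 < d) (hd4 : d ≠ 4) :
    ∃ s : ℕ, 6 * s ≤ (d + 1) * (d + 2) + 4 ∧ NonSpecial k (diagStrip 0 d 0) s := by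
  obtain ⟨n, hn⟩ : ∃ n, d = 3 * n ∨ d = 3 * n + 1 ∨ d = 3 * n + 2 := ⟨d / 3, by omega⟩
  rcases hn with rfl | rfl | rfl
  · rcases n with _ | _ | _ | n
    · omega
    · exact ⟨4, by norm_num, nonSpecial_cubics⟩
    · exact ⟨10, by norm_num, nonSpecial_sextics⟩
    · obtain ⟨s, hs, H⟩ := exists_nonSpecial_two_mod_three (k := k) n
      refine ⟨s + (4 * (n + 2 : ℕ) + 4), by linarith, ?_⟩
      refine NonSpecial.stack (m' := 3 * n + 6) (by ring) (by omega) (by push_cast; omega) H ?_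
      exact (nonSpecial_strip₄ (k := k) le_rfl nonSpecial_cubics (n + 2) 0).congr (by push_cast; ring) (by push_cast; ring) rfl
  · rcases n with _ | _ | n
    · omega
    · omega
    · obtain ⟨s, hs, H⟩ := exists_nonSpecial_two_mod_three (k := k) n
      refine ⟨s + (2 * (n + 2 : ℕ) + 1), by linarith, ?_⟩
      refine NonSpecial.stack (m' := 3 * n + 6) (by ring) (by omega) (by push_cast; omega) H ?_
      exact (nonSpecial_strip₂ (k := k) (n + 2) 0).congr (by push_cast; ring) (by push_cast; ring) rfl
  · rcases n with _ | n
    · omega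
    · obtain ⟨s, hs, H⟩ := exists_nonSpecial_two_mod_three (k := k) n
      refine ⟨s, by linarith, ?_⟩
      convert H using 2
      push_cast; ring

end Triangles

/-! ### Moments, the Jacobian criterion and dominant maps. -/

section Algebra

open MvPolynomial

theorem isSumOfPowers_iff {k : Type*} [CommRing k] {d s : ℕ} {F : MvPolynomial (Fin 3) k}
    (hF : F.IsHomogeneous d) :
    IsSumOfPowers d s F ↔ ∃ y : Fin s → Fin 3 → k, ∀ a : Fin 3 →₀ ℕ, a.degree = d →
      F.coeff a = a.multinomial * ∑ i, ∏ j, y i j ^ a j := by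
  have hcoeff : ∀ (y : Fin s → Fin 3 → k) (a : Fin 3 →₀ ℕ), a.degree = d →
      coeff a (∑ i, (∑ j, y i j • X j : MvPolynomial (Fin 3) k) ^ d) =
        a.multinomial * ∑ i, ∏ j, y i j ^ a j := by
    intro y a ha
    rw [coeff_sum, Finset.mul_sum]
    refine Finset.sum_congr rfl fun i _ => ?_
    have h : a.sum (fun _ m => m) = d := ha
    rw [coeff_linearCombination_X_pow_of_fintype, if_pos h, Finsupp.prod_fintype _ _ (by simp)]
  have hlin : ∀ y : Fin 3 → k, (∑ j, y j • X j : MvPolynomial (Fin 3) k).IsHomogeneous 1 :=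
    fun y => IsHomogeneous.sum _ _ _ fun j _ => by
      rw [smul_eq_C_mul]; simpa using (isHomogeneous_C _ (y j)).mul (isHomogeneous_X k j)
  have hpow : ∀ L : MvPolynomial (Fin 3) k, L.IsHomogeneous 1 → (L ^ d).IsHomogeneous d :=
    fun L hL => by simpa using hL.pow d
  constructor
  · rintro ⟨L, hL, rfl⟩
    have : ∀ i, ∃ y : Fin 3 → k, L i = ∑ j, y j • X j := by
      intro i
      refine ⟨fun j => coeff (Finsupp.single j 1) (L i), ?_⟩
      ext a
      by_cases ha : a.degree = 1
      · obtain ⟨j, rfl⟩ := (Finsupp.sum_eq_one_iff a).1 ha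
        simp [coeff_sum, coeff_smul, coeff_X, Finsupp.single_left_inj]
      · rw [(hL i).coeff_eq_zero ha, (hlin _).coeff_eq_zero ha]
    choose y hy using this
    refine ⟨y, fun a ha => ?_⟩
    rw [← hcoeff y a ha]
    simp only [hy]
  · rintro ⟨y, hy⟩
    refine ⟨fun i => ∑ j, y i j • X j, fun i => hlin _, ?_⟩
    ext a
    by_cases ha : a.degree = d
    · rw [hy a ha, hcoeff y a ha]
    · rw [hF.coeff_eq_zero ha,
        (IsHomogeneous.sum _ _ d fun i _ => hpow _ (hlin (y i))).coeff_eq_zero ha]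

theorem MvPolynomial.eq_C_of_pderiv_eq_zero {σ k : Type*} [Field k] [CharZero k]
    {P : MvPolynomial σ k} (h : ∀ i, pderiv i P = 0) : P = C (coeff 0 P) := by
  classical
  ext m
  rw [coeff_C]
  split_ifs with hm
  · rw [hm]
  · obtain ⟨i, hi⟩ : ∃ i, m i ≠ 0 := by
      by_contra! H
      exact hm (Finsupp.ext H).symm
    have := congrArg (coeff (m - Finsupp.single i 1)) (h i)
    rw [coeff_pderiv, tsub_add_cancel_of_le (Finsupp.single_le_iff.2 (Nat.one_le_iff_ne_zero.2 hi)),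
      coeff_zero] at this
    refine (mul_eq_zero.1 this).resolve_right ?_
    exact Nat.cast_add_one_ne_zero _

theorem MvPolynomial.totalDegree_pderiv_lt {σ k : Type*} [Field k]
    {P : MvPolynomial σ k} (h : P.totalDegree ≠ 0) (i : σ) :
    (pderiv i P).totalDegree < P.totalDegree := by
  refine (Finset.sup_lt_iff (Nat.pos_of_ne_zero h)).2 fun m hm => ?_
  rw [mem_support_iff, coeff_pderiv] at hm
  have := le_totalDegree (mem_support_iff.2 (left_ne_zero_of_mul hm))
  rw [Finsupp.sum_add_index' (by simp) (by simp), Finsupp.sum_single_index rfl] at this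
  omega

theorem MvPolynomial.pderiv_aeval {T J k : Type*} [Field k] [Fintype T]
    (φ : T → MvPolynomial J k) (P : MvPolynomial T k) (j : J) :
    pderiv j (aeval φ P) = ∑ t, aeval φ (pderiv t P) * pderiv j (φ t) := by
  classical
  induction P using MvPolynomial.induction_on with
  | C a => simp
  | add p q hp hq => simp only [map_add, hp, hq, add_mul, Finset.sum_add_distrib]
  | mul_X p s hp =>
    simp only [map_mul, aeval_X, pderiv_mul, hp, map_add, add_mul, Finset.sum_add_distrib,
      Finset.sum_mul, pderiv_X]
    congr 1
    · exact Finset.sum_congr rfl fun t _ => by ring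
    · rw [Finset.sum_eq_single s] <;> simp +contextual

/-- The Jacobian criterion for algebraic independence in characteristic zero. -/
theorem algebraicIndependent_of_jacobian {T J k : Type*} [Field k] [CharZero k] [Fintype T]
    [Fintype J] (φ : T → MvPolynomial J k) (y : J → k)
    (h : ∀ v : T → k, (∀ j, ∑ t, v t * eval y (pderiv j (φ t)) = 0) → v = 0) :
    AlgebraicIndependent k φ := by
  classical
  obtain ⟨R, hR⟩ := Matrix.exists_mul_eq_one_of_mulVec_injective
    (Matrix.of fun j t => eval y (pderiv j (φ t)))
    (fun v hv => h v fun j => by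
      rw [← Pi.zero_apply (M := fun _ => k) j, ← hv]
      exact Finset.sum_congr rfl fun t _ => mul_comm _ _)
  let N : Matrix J T (MvPolynomial J k) := Matrix.of fun j t => pderiv j (φ t)
  let R' : Matrix T J (MvPolynomial J k) := R.map C
  -- Full rank at the point `y` implies full rank over the polynomial ring.
  have hind : ∀ b : T → MvPolynomial J k, (∀ j, ∑ t, b t * pderiv j (φ t) = 0) → b = 0 := by
    intro b hb
    have hdet : (R' * N).det ≠ 0 := by
      intro h0
      have hRN : (R' * N).map (eval y) = 1 := by
        rw [Matrix.map_mul, ← hR]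
        congr 1
        ext; simp [R']
      have := congrArg (eval y) h0
      rw [RingHom.map_det, RingHom.mapMatrix_apply, hRN, Matrix.det_one, map_zero] at this
      exact one_ne_zero this
    refine Matrix.eq_zero_of_mulVec_eq_zero hdet ?_
    have : N.mulVec b = 0 := by
      ext1 j
      rw [Pi.zero_apply, ← hb j]
      exact Finset.sum_congr rfl fun t _ => mul_comm _ _
    rw [← Matrix.mulVec_mulVec, this, Matrix.mulVec_zero]
  rw [algebraicIndependent_iff]
  intro P
  induction hn : P.totalDegree using Nat.strong_induction_on generalizing P with
  | _ n ih =>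
    intro hP
    -- Differentiating the relation `P` shows by `hind` that its partial derivatives are relations
    -- too, of smaller degree; so they vanish and `P` is constant.
    have hd : ∀ t, pderiv t P = 0 := by
      by_cases h0 : P.totalDegree = 0
      · intro t
        rw [totalDegree_eq_zero_iff_eq_C.1 h0, pderiv_C]
      · have := hind (fun t => aeval φ (pderiv t P)) fun j => by
          rw [← pderiv_aeval, hP, map_zero]
        exact fun t => ih _ (hn ▸ totalDegree_pderiv_lt h0 t) _ rfl (congrFun this t)
    rw [eq_C_of_pderiv_eq_zero hd] at hP ⊢
    simpa using hP

/-- A polynomial map with algebraically independent components is dominant: its image contains a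
nonempty principal open set. -/
theorem exists_forall_eval_ne_zero {T J k : Type*} [Field k] [IsAlgClosed k] [Finite T]
    [Finite J] {φ : T → MvPolynomial J k} (h : AlgebraicIndependent k φ) :
    ∃ Φ : MvPolynomial T k, Φ ≠ 0 ∧ ∀ c : T → k, eval c Φ ≠ 0 →
      ∃ y : J → k, ∀ t, eval y (φ t) = c t := by
  set f : MvPolynomial T k →+* MvPolynomial J k := (aeval φ).toRingHom with hf
  have hinj : Function.Injective f := h
  have hfin : f.FinitePresentation := by
    rw [← RingHom.FinitePresentation.of_finiteType]
    refine RingHom.FiniteType.of_comp_finiteType (f := (C : k →+* MvPolynomial T k)) ?_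
    have : f.comp C = algebraMap k (MvPolynomial J k) := by ext; simp [hf]
    rw [this, RingHom.finiteType_algebraMap]
    infer_instance
  -- Chevalley: the image is constructible. It contains the generic point `η` because `f` is
  -- injective, and a locally closed piece containing `η` is a principal open set.
  obtain ⟨S, hS⟩ := PrimeSpectrum.exists_constructibleSetData_iff.2
    (PrimeSpectrum.isConstructible_range_comap hfin)
  let η : PrimeSpectrum (MvPolynomial T k) := ⟨⊥, Ideal.isPrime_bot⟩
  have hη : η ∈ S.toSet := by
    rw [hS]
    refine ⟨⟨⊥, Ideal.isPrime_bot⟩, ?_⟩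
    ext1
    exact (RingHom.injective_iff_ker_eq_bot f).1 hinj
  simp only [PrimeSpectrum.ConstructibleSetData.toSet, Set.mem_iUnion] at hη
  obtain ⟨D, hD, hηD⟩ := hη
  have hDS : D.toSet ⊆ Set.range (PrimeSpectrum.comap f) := by
    rw [← hS]
    exact Set.subset_biUnion_of_mem (u := fun D => D.toSet) hD
  have hg : ∀ i, D.g i = 0 := by
    intro i
    have := (PrimeSpectrum.mem_zeroLocus _ _).1 hηD.1 (Set.mem_range_self i)
    simpa [η] using this
  have hf0 : D.f ≠ 0 := by
    intro h0
    exact hηD.2 (by simp [h0])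
  refine ⟨D.f, hf0, fun c hc => ?_⟩
  obtain ⟨q, hq⟩ := hDS (a := pointToPoint c) (by
    refine ⟨?_, ?_⟩
    · rw [PrimeSpectrum.mem_zeroLocus]
      rintro _ ⟨i, rfl⟩
      simp [hg i]
    · rw [PrimeSpectrum.mem_zeroLocus, Set.singleton_subset_iff]
      simpa [pointToPoint, mem_vanishingIdeal_singleton_iff, aeval_def] using hc)
  -- The prime above the point `c` need not be closed; a maximal ideal containing it is, and it
  -- still lies above `c`.
  obtain ⟨M, hM, hqM⟩ := Ideal.exists_le_maximal q.asIdeal q.isPrime.ne_top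
  obtain ⟨y, rfl⟩ := eq_vanishingIdeal_singleton_of_isMaximal k hM
  refine ⟨y, fun t => ?_⟩
  have h1 : X t - C (c t) ∈ (pointToPoint (k := k) c).asIdeal := by
    simp [pointToPoint]
  rw [← hq] at h1
  have h2 := hqM h1
  rw [mem_vanishingIdeal_singleton_iff] at h2
  simpa [hf, sub_eq_zero, aeval_def] using h2

end Algebra

/-! ### The rank of the generic form. -/

section Generic

open MvPolynomial

theorem IsSumOfPowers.mono {σ k : Type*} [CommSemiring k] {d s t : ℕ} {F : MvPolynomial σ k}
    (hd : d ≠ 0) (hst : s ≤ t) (h : IsSumOfPowers d s F) : IsSumOfPowers d t F := by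
  obtain ⟨L, hL, rfl⟩ := h
  obtain ⟨e, rfl⟩ := Nat.exists_eq_add_of_le hst
  refine ⟨Fin.append L 0, fun i => ?_, ?_⟩
  · refine Fin.addCases (fun i => ?_) (fun j => ?_) i
    · simpa using hL i
    · simpa using isHomogeneous_zero σ k 1
  · simp [Fin.sum_univ_add, hd]

theorem waringRank_le {σ k : Type*} [CommSemiring k] {d s : ℕ} {F : MvPolynomial σ k}
    (h : IsSumOfPowers d s F) : waringRank d F ≤ s :=
  sInf_le ⟨s, h, rfl⟩

theorem le_waringRank {σ k : Type*} [CommSemiring k] {d r : ℕ} {F : MvPolynomial σ k}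
    (h : ∀ s, IsSumOfPowers d s F → r ≤ s) : (r : ℕ∞) ≤ waringRank d F := by
  refine le_sInf ?_
  rintro _ ⟨s, hs, rfl⟩
  exact Nat.cast_le.2 (h s hs)

/-- The exponents of the ternary monomials of degree `d`. -/
def ternaryExponents (d : ℕ) : Finset (Fin 3 →₀ ℕ) := Finset.finsuppAntidiag Finset.univ d

theorem mem_ternaryExponents {d : ℕ} {a : Fin 3 →₀ ℕ} :
    a ∈ ternaryExponents d ↔ a.degree = d := by
  rw [ternaryExponents, Finset.mem_finsuppAntidiag, Finsupp.degree_eq_sum]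
  simp

theorem degree_fin_three (a : Fin 3 →₀ ℕ) : a.degree = a 0 + a 1 + a 2 := by
  rw [Finsupp.degree_eq_sum, Fin.sum_univ_three]

theorem card_ternaryExponents (d : ℕ) : (ternaryExponents d).card = (d + 2).choose 2 := by
  rw [ternaryExponents, Finset.card_finsuppAntidiag_nat_eq_choose]
  rw [Finset.card_univ, Fintype.card_fin, show 3 + d - 1 = d + 2 by omega]
  exact Nat.choose_symm_add

variable {k : Type*} [Field k]

/-- The coefficient at `a` of the `a.degree`-th power sum of `s` generic linear forms. -/
noncomputable def powerSumCoeff (k : Type*) [Field k] (s : ℕ) (a : Fin 3 →₀ ℕ) :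
    MvPolynomial (Fin s × Fin 3) k :=
  ∑ i, monomial (a.mapDomain (Prod.mk i)) (a.multinomial : k)

theorem mapDomain_prodMk {s : ℕ} (i i' : Fin s) (j : Fin 3) (a : Fin 3 →₀ ℕ) :
    a.mapDomain (Prod.mk i) (i', j) = if i = i' then a j else 0 := by
  split_ifs with h
  · subst h
    exact Finsupp.mapDomain_apply (Prod.mk_right_injective i) _ _
  · refine Finsupp.mapDomain_of_notMem_range _ _ ?_
    rintro ⟨_, h'⟩
    exact h (congrArg Prod.fst h')

theorem eval_monomial_mapDomain {s : ℕ} (y : Fin s × Fin 3 → k) (i : Fin s) (a : Fin 3 →₀ ℕ)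
    (c : k) : eval y (monomial (a.mapDomain (Prod.mk i)) c) = c * ∏ j, y (i, j) ^ a j := by
  rw [eval_monomial, Finsupp.prod_mapDomain_index_inj (Prod.mk_right_injective i),
    Finsupp.prod_fintype _ _ (by simp)]

theorem eval_powerSumCoeff {s : ℕ} (y : Fin s × Fin 3 → k) (a : Fin 3 →₀ ℕ) :
    eval y (powerSumCoeff k s a) = a.multinomial * ∑ i, ∏ j, y (i, j) ^ a j := by
  simp only [powerSumCoeff, map_sum, eval_monomial_mapDomain, Finset.mul_sum]

theorem eval_pderiv_powerSumCoeff {s : ℕ} (y : Fin s × Fin 3 → k) (a : Fin 3 →₀ ℕ) (i : Fin s)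
    (j : Fin 3) : y (i, j) * eval y (pderiv (i, j) (powerSumCoeff k s a)) =
      a j * (a.multinomial * ∏ l, y (i, l) ^ a l) := by
  rw [← eval_X (f := y) (i, j), ← map_mul, powerSumCoeff, map_sum, Finset.mul_sum,
    Finset.sum_eq_single i]
  · rw [X_mul_pderiv_monomial, map_nsmul, eval_monomial_mapDomain, mapDomain_prodMk, if_pos rfl,
      nsmul_eq_mul]
  · intro i' _ h
    rw [X_mul_pderiv_monomial, mapDomain_prodMk, if_neg h, zero_smul]
  · simp

theorem isSumOfPowers_iff_eval {d s : ℕ} {F : MvPolynomial (Fin 3) k} (hF : F.IsHomogeneous d) :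
    IsSumOfPowers d s F ↔ ∃ y : Fin s × Fin 3 → k,
      ∀ a ∈ ternaryExponents d, eval y (powerSumCoeff k s a) = F.coeff a := by
  rw [isSumOfPowers_iff hF]
  constructor
  · rintro ⟨y, hy⟩
    refine ⟨fun p => y p.1 p.2, fun a ha => ?_⟩
    rw [eval_powerSumCoeff, hy a (mem_ternaryExponents.1 ha)]
  · rintro ⟨y, hy⟩
    refine ⟨fun i j => y (i, j), fun a ha => ?_⟩
    rw [← hy a (mem_ternaryExponents.2 ha), eval_powerSumCoeff]

theorem Finsupp.multinomial_ne_zero (k : Type*) [Field k] [CharZero k] {α : Type*} (a : α →₀ ℕ) :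
    (a.multinomial : k) ≠ 0 := by
  rw [Finsupp.multinomial_eq]
  exact_mod_cast (Nat.multinomial_pos _ _).ne'

/-- A form of Terracini's lemma. -/
theorem algebraicIndependent_powerSumCoeff [CharZero k] {d s : ℕ} (hd : d ≠ 0)
    (h : NonSpecial k (diagStrip 0 d 0) s) :
    AlgebraicIndependent k fun a : ternaryExponents d => powerSumCoeff k s a := by
  obtain ⟨p, hp, H⟩ := h
  -- The torus points are lifted to linear forms with first coefficient `1`. A relation `v` between
  -- the differentials then becomes a polynomial, with coefficients `v a` times multinomials,
  -- singular at every `p i`.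
  set y : Fin s × Fin 3 → k := fun q => ![1, (p q.1).1, (p q.1).2] q.2 with hy
  refine algebraicIndependent_of_jacobian _ y fun v hv => ?_
  have hv' : ∀ i j, ∑ a : ternaryExponents d, v a * (a.1.multinomial : k) *
      ((a.1 j : k) * ((p i).1 ^ a.1 1 * (p i).2 ^ a.1 2)) = 0 := by
    intro i j
    rw [← mul_zero (y (i, j)), ← hv (i, j), Finset.mul_sum]
    refine Finset.sum_congr rfl fun a _ => ?_
    rw [mul_left_comm (y (i, j)), eval_pderiv_powerSumCoeff, Fin.prod_univ_three]
    simp [hy]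
    ring
  let g : ternaryExponents d → ℤ × ℤ := fun a => (a.1 1, a.1 2)
  have hg : Function.Injective g := by
    intro a b hab
    have h1 := mem_ternaryExponents.1 a.2
    have h2 := mem_ternaryExponents.1 b.2
    rw [degree_fin_three] at h1 h2
    simp only [g, Prod.mk.injEq, Nat.cast_inj] at hab
    ext j
    fin_cases j
    · simp; omega
    · simpa using hab.1
    · simpa using hab.2
  have hgmem : ∀ a, g a ∈ diagStrip 0 d 0 := by
    intro a
    have h1 := mem_ternaryExponents.1 a.2
    rw [degree_fin_three] at h1
    rw [mem_diagStrip]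
    simp only [g]
    omega
  have key := H (fun b => ∑ a, if g a = b then v a * (a.1.multinomial : k) else 0) fun i => by
    have swap : ∀ m, ∑ b ∈ diagStrip 0 d 0,
        (∑ a, if g a = b then v a * (a.1.multinomial : k) else 0) * logDeriv₃ (p i) b m =
        ∑ a, v a * (a.1.multinomial : k) * logDeriv₃ (p i) (g a) m := by
      intro m
      simp only [Finset.sum_mul, ite_mul, zero_mul]
      rw [Finset.sum_comm]
      refine Finset.sum_congr rfl fun a _ => ?_
      rw [Finset.sum_ite_eq, if_pos (hgmem a)]
    intro m
    rw [swap]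
    fin_cases m
    -- Euler's relation: the three logarithmic derivatives add up to `d` times the value.
    · have h0 := congrArg₂ (· + ·) (congrArg₂ (· + ·) (hv' i 0) (hv' i 1)) (hv' i 2)
      simp only [← Finset.sum_add_distrib, add_zero] at h0
      refine (mul_eq_zero.1 (?_ : (d : k) * _ = 0)).resolve_left (Nat.cast_ne_zero.2 hd)
      rw [← h0, Finset.mul_sum]
      refine Finset.sum_congr rfl fun a _ => ?_
      have h1 := mem_ternaryExponents.1 a.2
      rw [degree_fin_three] at h1
      have h2 : (d : k) = a.1 0 + a.1 1 + a.1 2 := by exact_mod_cast h1.symm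
      simp [logDeriv₃, g, h2]
      ring
    · rw [← hv' i 1]
      refine Finset.sum_congr rfl fun a _ => ?_
      change _ * (_ ^ (a.1 1 : ℤ) * _ ^ (a.1 2 : ℤ) * ((a.1 1 : ℤ) : k)) = _
      rw [Int.cast_natCast, zpow_natCast, zpow_natCast]
      ring
    · rw [← hv' i 2]
      refine Finset.sum_congr rfl fun a _ => ?_
      change _ * (_ ^ (a.1 1 : ℤ) * _ ^ (a.1 2 : ℤ) * ((a.1 2 : ℤ) : k)) = _
      rw [Int.cast_natCast, zpow_natCast, zpow_natCast]
      ring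
  ext a
  have := key (g a) (hgmem a)
  simp only [hg.eq_iff, Finset.sum_ite_eq', Finset.mem_univ, if_true] at this
  exact (mul_eq_zero.1 this).resolve_right (Finsupp.multinomial_ne_zero k _)

/-- There are more coefficients than the `3 * s` parameters, so transcendence degree forces a
relation. -/
theorem exists_aeval_powerSumCoeff_eq_zero {d s : ℕ} (h : 3 * s < (d + 2).choose 2) :
    ∃ P : MvPolynomial (ternaryExponents d) k, P ≠ 0 ∧
      aeval (fun a : ternaryExponents d => powerSumCoeff k s a) P = 0 := by
  by_contra! H
  have hind : AlgebraicIndependent k fun a : ternaryExponents d => powerSumCoeff k s a :=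
    algebraicIndependent_iff.2 fun P hP => by_contra fun h0 => H P h0 hP
  have := hind.lift_cardinalMk_le_trdeg
  rw [MvPolynomial.trdeg_of_isDomain] at this
  simp only [Cardinal.mk_fintype, Cardinal.lift_natCast, Fintype.card_coe,
    card_ternaryExponents, Fintype.card_prod, Fintype.card_fin, Nat.cast_le] at this
  omega

theorem isGenericTernaryRank [CharZero k] [IsAlgClosed k] {d r s : ℕ} (hd : d ≠ 0)
    (hs : NonSpecial k (diagStrip 0 d 0) s) (hsr : s ≤ r)
    (hr : 3 * (r - 1) < (d + 2).choose 2) : IsGenericTernaryRank k d r := by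
  obtain ⟨Q, hQ0, hQ⟩ := exists_forall_eval_ne_zero (algebraicIndependent_powerSumCoeff hd hs)
  obtain ⟨P, hP0, hP⟩ := exists_aeval_powerSumCoeff_eq_zero (k := k) hr
  have heval : ∀ F : MvPolynomial (Fin 3) k,
      eval (fun a => F.coeff a) (rename Subtype.val (P * Q)) =
        eval (fun a : ternaryExponents d => F.coeff a.1) P *
          eval (fun a : ternaryExponents d => F.coeff a.1) Q := by
    intro F
    rw [eval_rename, map_mul]
    rfl
  -- `Q ≠ 0` makes `s` powers sufficient; `P ≠ 0` excludes every sum of `r - 1` powers.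
  refine ⟨rename Subtype.val (P * Q), ?_, fun F hF hΦ => ?_⟩
  · obtain ⟨c, hc⟩ : ∃ c, eval c (P * Q) ≠ 0 := by
      by_contra! h
      exact mul_ne_zero hP0 hQ0 (MvPolynomial.funext fun c => by simpa using h c)
    refine ⟨∑ a, monomial a.1 (c a), IsHomogeneous.sum _ _ _ fun a _ =>
      isHomogeneous_monomial _ (mem_ternaryExponents.1 a.2), ?_⟩
    have : (fun b : ternaryExponents d => coeff b.1 (∑ a, monomial a.1 (c a))) = c := by
      ext b
      simp only [coeff_sum, coeff_monomial, Subtype.val_inj, Finset.sum_ite_eq', Finset.mem_univ,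
        if_true]
    rw [heval, this, ← map_mul]
    exact hc
  · rw [heval] at hΦ
    refine le_antisymm ?_ ?_
    · obtain ⟨y, hy⟩ := hQ _ (right_ne_zero_of_mul hΦ)
      exact waringRank_le (((isSumOfPowers_iff_eval hF).2 ⟨y, fun a ha => hy ⟨a, ha⟩⟩).mono hd hsr)
    · refine le_waringRank fun t ht => ?_
      by_contra! hlt
      obtain ⟨y, hy⟩ := (isSumOfPowers_iff_eval hF).1 (ht.mono hd (Nat.le_sub_one_of_lt hlt))
      refine left_ne_zero_of_mul hΦ ?_
      have h1 : aeval y (aeval (fun a : ternaryExponents d => powerSumCoeff k (r - 1) a) P) =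
          aeval (fun a : ternaryExponents d => F.coeff a.1) P := by
        rw [← AlgHom.comp_apply, comp_aeval]
        have hy' : ∀ a : ternaryExponents d,
            aeval y (powerSumCoeff k (r - 1) a) = F.coeff a.1 := fun a => hy a a.2
        simp only [hy']
      rw [hP, map_zero] at h1
      exact h1.symm

theorem isGenericTernaryRank_ceil [CharZero k] [IsAlgClosed k] {d : ℕ} (hd : 2 < d) (hd4 : d ≠ 4) :
    IsGenericTernaryRank k d ⌈((d + 2).choose 2 : ℚ) / 3⌉₊ := by
  obtain ⟨s, hs, H⟩ := exists_nonSpecial_triangle (k := k) hd hd4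
  have hN : 2 * (d + 2).choose 2 = (d + 1) * (d + 2) := by
    rw [Nat.choose_two_right, Nat.mul_div_cancel' (Nat.even_mul_pred_self _).two_dvd]
    simp; ring
  have hNpos : 0 < (d + 2).choose 2 := Nat.choose_pos (by omega)
  refine isGenericTernaryRank (by omega) H ?_ ?_
  · by_contra! hlt
    have h1 := Nat.ceil_le.1 (Nat.le_sub_one_of_lt hlt)
    rw [div_le_iff₀ (by norm_num)] at h1
    have h2 : (d + 2).choose 2 ≤ (s - 1) * 3 := by exact_mod_cast h1
    omega
  · have hpos : 0 < ⌈((d + 2).choose 2 : ℚ) / 3⌉₊ := Nat.ceil_pos.2 (by positivity)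
    have h1 := Nat.lt_ceil.1 (Nat.sub_one_lt hpos.ne')
    rw [lt_div_iff₀ (by norm_num)] at h1
    have h2 : (⌈((d + 2).choose 2 : ℚ) / 3⌉₊ - 1) * 3 < (d + 2).choose 2 := by exact_mod_cast h1
    omega

end Generic

/-! ### Bounds for the ranks of monomials. -/

section Monomials

open MvPolynomial

variable {k : Type*} [Field k]

/-- Weights are absorbed into the linear forms by taking `d`-th roots. -/
theorem IsSumOfPowers.of_weighted [IsAlgClosed k] {d : ℕ} (hd : d ≠ 0) {F : MvPolynomial (Fin 3) k}
    (hF : F.IsHomogeneous d) {ι : Type*} [Fintype ι] (w : ι → k) (y : ι → Fin 3 → k)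
    (h : ∀ a : Fin 3 →₀ ℕ, a.degree = d →
      F.coeff a = a.multinomial * ∑ i, w i * ∏ j, y i j ^ a j) :
    IsSumOfPowers d (Fintype.card ι) F := by
  choose u hu using fun i => IsAlgClosed.exists_pow_nat_eq (w i) (Nat.pos_of_ne_zero hd)
  refine (isSumOfPowers_iff hF).2
    ⟨fun i j => u ((Fintype.equivFin ι).symm i) * y ((Fintype.equivFin ι).symm i) j, fun a ha => ?_⟩
  rw [h a ha, (Fintype.equivFin ι).symm.sum_comp (fun i => ∏ j, (u i * y i j) ^ a j)]
  congr 1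
  refine Finset.sum_congr rfl fun i _ => ?_
  simp only [mul_pow]
  rw [Finset.prod_mul_distrib, Finset.prod_pow_eq_pow_sum, ← Finsupp.degree_eq_sum, ha, hu]

theorem IsPrimitiveRoot.sum_pow_mul {n : ℕ} {ω : k} (hω : IsPrimitiveRoot ω n) (t : ℕ) :
    ∑ i : Fin n, (ω ^ (i : ℕ)) ^ t = if n ∣ t then (n : k) else 0 := by
  simp only [← pow_mul, mul_comm _ t]
  simp only [pow_mul]
  rw [Fin.sum_univ_eq_sum_range (fun i => (ω ^ t) ^ i)]
  split_ifs with h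
  · simp [(hω.pow_eq_one_iff_dvd t).2 h]
  · have h1 : ω ^ t ≠ 1 := fun h1 => h ((hω.pow_eq_one_iff_dvd t).1 h1)
    rw [geom_sum_eq h1, ← pow_mul, mul_comm, pow_mul, hω.pow_eq_one]
    simp

theorem exists_isPrimitiveRoot_succ (k : Type*) [Field k] [IsAlgClosed k] [CharZero k] (n : ℕ) :
    ∃ ω : k, IsPrimitiveRoot ω (n + 1) :=
  haveI : NeZero ((n + 1 : ℕ) : k) := ⟨Nat.cast_ne_zero.2 n.succ_ne_zero⟩
  HasEnoughRootsOfUnity.exists_primitiveRoot k (n + 1)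

theorem Finsupp.degree_fin_three_perm (σ : Equiv.Perm (Fin 3)) (a : Fin 3 →₀ ℕ) :
    a.degree = a (σ 0) + a (σ 1) + a (σ 2) := by
  rw [Finsupp.degree_eq_sum, ← Equiv.sum_comp σ, Fin.sum_univ_three]

theorem Finsupp.ext_fin_three_perm (σ : Equiv.Perm (Fin 3)) {a b : Fin 3 →₀ ℕ}
    (h0 : a (σ 0) = b (σ 0)) (h1 : a (σ 1) = b (σ 1)) (h2 : a (σ 2) = b (σ 2)) : a = b := by
  ext j
  obtain ⟨i, rfl⟩ := σ.surjective j
  fin_cases i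
  exacts [h0, h1, h2]

variable [IsAlgClosed k] [CharZero k]

theorem isSumOfPowers_monomial (a : Fin 3 →₀ ℕ) (hd : a.degree ≠ 0) (σ : Equiv.Perm (Fin 3))
    (h1 : a (σ 0) ≤ a (σ 1)) (h2 : a (σ 0) ≤ a (σ 2)) :
    IsSumOfPowers a.degree ((a (σ 1) + 1) * (a (σ 2) + 1)) (monomial a (1 : k)) := by
  obtain ⟨ω, hω⟩ := exists_isPrimitiveRoot_succ k (a (σ 1))
  obtain ⟨ξ, hξ⟩ := exists_isPrimitiveRoot_succ k (a (σ 2))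
  have hK : (a.multinomial : k) * ((a (σ 1) + 1 : ℕ) * (a (σ 2) + 1 : ℕ)) ≠ 0 :=
    mul_ne_zero (Finsupp.multinomial_ne_zero k a)
      (mul_ne_zero (Nat.cast_ne_zero.2 (Nat.succ_ne_zero _))
        (Nat.cast_ne_zero.2 (Nat.succ_ne_zero _)))
  set K := (a.multinomial : k) * ((a (σ 1) + 1 : ℕ) * (a (σ 2) + 1 : ℕ)) with hKdef
  have := IsSumOfPowers.of_weighted hd (isHomogeneous_monomial (1 : k) rfl)
    (ι := Fin (a (σ 1) + 1) × Fin (a (σ 2) + 1))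
    (fun i => K⁻¹ * (ω ^ (i.1 : ℕ) * ξ ^ (i.2 : ℕ)))
    (fun i j => ![1, ω ^ (i.1 : ℕ), ξ ^ (i.2 : ℕ)] (σ.symm j)) (fun b hb => ?_)
  · simpa using this
  have hsum : ∑ i : Fin (a (σ 1) + 1) × Fin (a (σ 2) + 1),
      K⁻¹ * (ω ^ (i.1 : ℕ) * ξ ^ (i.2 : ℕ)) *
        ∏ j, ![1, ω ^ (i.1 : ℕ), ξ ^ (i.2 : ℕ)] (σ.symm j) ^ b j =
      K⁻¹ * ((∑ i : Fin (a (σ 1) + 1), (ω ^ (i : ℕ)) ^ (b (σ 1) + 1)) *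
        ∑ i : Fin (a (σ 2) + 1), (ξ ^ (i : ℕ)) ^ (b (σ 2) + 1)) := by
    rw [Finset.sum_mul_sum, ← Finset.sum_product', Finset.mul_sum, Finset.univ_product_univ]
    refine Finset.sum_congr rfl fun i _ => ?_
    rw [← Equiv.prod_comp σ, Fin.prod_univ_three]
    simp
    ring
  rw [hsum, hω.sum_pow_mul, hξ.sum_pow_mul, coeff_monomial]
  rw [Finsupp.degree_fin_three_perm σ a, Finsupp.degree_fin_three_perm σ b] at hb
  by_cases hab : a = b
  · subst hab
    rw [if_pos rfl, if_pos dvd_rfl, if_pos dvd_rfl, mul_left_comm, ← hKdef, inv_mul_cancel₀ hK]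
  · rw [if_neg hab, ite_zero_mul_ite_zero, if_neg, mul_zero, mul_zero]
    -- The surviving exponents satisfy `b₁ + 1 = (a₁ + 1) u` and `b₂ + 1 = (a₂ + 1) v`. As `a₀` is
    -- minimal, `u ≥ 2` or `v ≥ 2` would make the degree exceed `a₀ + a₁ + a₂`.
    rintro ⟨⟨u, hu⟩, v, hv⟩
    have hu0 : u ≠ 0 := by rintro rfl; simp at hu
    have hv0 : v ≠ 0 := by rintro rfl; simp at hv
    have hu' : a (σ 1) + 1 ≤ (a (σ 1) + 1) * u :=
      Nat.le_mul_of_pos_right _ (Nat.pos_of_ne_zero hu0)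
    have hv' : a (σ 2) + 1 ≤ (a (σ 2) + 1) * v :=
      Nat.le_mul_of_pos_right _ (Nat.pos_of_ne_zero hv0)
    have hu1 : u = 1 := by
      by_contra hne
      have := Nat.mul_le_mul_left (a (σ 1) + 1) (show 2 ≤ u by omega)
      omega
    have hv1 : v = 1 := by
      by_contra hne
      have := Nat.mul_le_mul_left (a (σ 2) + 1) (show 2 ≤ v by omega)
      omega
    subst hu1 hv1
    exact hab (Finsupp.ext_fin_three_perm σ (by omega) (by omega) (by omega))

theorem isSumOfPowers_monomial_of_eq_zero (a : Fin 3 →₀ ℕ) (hd : a.degree ≠ 0)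
    (σ : Equiv.Perm (Fin 3)) (h0 : a (σ 0) = 0) :
    IsSumOfPowers a.degree (a.degree + 1) (monomial a (1 : k)) := by
  obtain ⟨ξ, hξ⟩ := exists_isPrimitiveRoot_succ k a.degree
  have hda := Finsupp.degree_fin_three_perm σ a
  have hK : (a.multinomial : k) * (a.degree + 1 : ℕ) ≠ 0 :=
    mul_ne_zero (Finsupp.multinomial_ne_zero k a) (Nat.cast_ne_zero.2 (Nat.succ_ne_zero _))
  set K := (a.multinomial : k) * (a.degree + 1 : ℕ) with hKdef
  have := IsSumOfPowers.of_weighted hd (isHomogeneous_monomial (1 : k) rfl)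
    (fun i : Fin (a.degree + 1) => K⁻¹ * (ξ ^ (i : ℕ)) ^ (a (σ 1) + 1))
    (fun i j => ![0, 1, ξ ^ (i : ℕ)] (σ.symm j)) (fun b hb => ?_)
  · simpa using this
  have hdb := Finsupp.degree_fin_three_perm σ b
  have hsum : ∑ i : Fin (a.degree + 1), K⁻¹ * (ξ ^ (i : ℕ)) ^ (a (σ 1) + 1) *
      ∏ j, ![0, 1, ξ ^ (i : ℕ)] (σ.symm j) ^ b j =
      K⁻¹ * (0 ^ b (σ 0) *
        ∑ i : Fin (a.degree + 1), (ξ ^ (i : ℕ)) ^ (a (σ 1) + 1 + b (σ 2))) := by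
    rw [Finset.mul_sum, Finset.mul_sum]
    refine Finset.sum_congr rfl fun i _ => ?_
    rw [← Equiv.prod_comp σ, Fin.prod_univ_three]
    simp
    ring
  rw [hsum, hξ.sum_pow_mul, coeff_monomial]
  by_cases hab : a = b
  · subst hab
    rw [if_pos rfl, if_pos (by rw [hda]; exact ⟨1, by omega⟩), h0, pow_zero, one_mul,
      mul_left_comm, ← hKdef, inv_mul_cancel₀ hK]
  · rw [if_neg hab]
    by_cases hb0 : b (σ 0) = 0
    · rw [if_neg, mul_zero, mul_zero, mul_zero]
      rintro ⟨u, hu⟩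
      rcases u with _ | _ | u
      · omega
      · exact hab (Finsupp.ext_fin_three_perm σ (by omega) (by omega) (by omega))
      · have := Nat.mul_le_mul_left (a.degree + 1) (show 2 ≤ u + 1 + 1 by omega)
        omega
    · rw [zero_pow hb0]
      simp

omit [IsAlgClosed k] in
theorem le_of_isSumOfPowers_monomial {a : Fin 3 →₀ ℕ} (h0 : a 0 = 1) {s : ℕ}
    (h : IsSumOfPowers a.degree s (monomial a (1 : k))) : (a 1 + 1) * (a 2 + 1) ≤ s := by
  obtain ⟨y, hy⟩ := (isSumOfPowers_iff (isHomogeneous_monomial (1 : k) rfl)).1 h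
  have hda := degree_fin_three a
  have hmom : ∀ p q r : ℕ, p + q + r = a.degree → (p, q, r) ≠ (1, a 1, a 2) →
      ∑ i, y i 0 ^ p * y i 1 ^ q * y i 2 ^ r = 0 := by
    intro p q r hpqr hne
    let b : Fin 3 →₀ ℕ := Finsupp.equivFunOnFinite.symm ![p, q, r]
    have hb := hy b (by rw [degree_fin_three]; simpa [b] using hpqr)
    rw [coeff_monomial, if_neg, eq_comm] at hb
    · have := (mul_eq_zero.1 hb).resolve_left (Finsupp.multinomial_ne_zero k b)
      simpa [Fin.prod_univ_three, b] using this
    · rintro hab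
      apply hne
      rw [← h0, hab]
      simp [b]
  have hmom1 : ∑ i, y i 0 ^ 1 * y i 1 ^ a 1 * y i 2 ^ a 2 ≠ 0 := by
    intro h
    have hb := hy a rfl
    simp only [Fin.prod_univ_three, h0, h] at hb
    simp at hb
  by_contra! hlt
  classical
  -- The box monomials at the dehomogenized points. Where `y i 0 = 0`, division gives the point `(0,
  -- 0)`; this costs at most the one row already counted.
  let E : Matrix (Fin s) (Fin (a 1 + 1) × Fin (a 2 + 1)) k := Matrix.of fun i b =>
    (y i 1 / y i 0) ^ (b.1 : ℕ) * (y i 2 / y i 0) ^ (b.2 : ℕ)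
  obtain ⟨g, hgker, hg⟩ := (Submodule.ne_bot_iff _).1
    (LinearMap.ker_ne_bot_of_finrank_lt (f := E.mulVecLin) (by simpa using hlt))
  have hE : ∀ i, ∑ b, (y i 1 / y i 0) ^ (b.1 : ℕ) * (y i 2 / y i 0) ^ (b.2 : ℕ) * g b = 0 :=
    fun i => congrFun (LinearMap.mem_ker.1 hgker) i
  obtain ⟨b₀, hb₀, hmax⟩ := Finset.exists_max_image (Finset.univ.filter fun b => g b ≠ 0)
    (fun b => (b.1 + b.2 : ℕ)) (by
      obtain ⟨b, hb⟩ := Function.ne_iff.1 hg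
      exact ⟨b, by simpa using hb⟩)
  simp only [Finset.mem_filter, Finset.mem_univ, true_and] at hb₀ hmax
  have hj := b₀.1.2
  have hl := b₀.2.2
  set e : ℕ := b₀.1 + b₀.2 with he
  -- The polynomial `g`, homogenized to its top degree `e`, is multiplied by the monomial that
  -- carries its top term `b₀` to `a`. The factor `y i 0` makes the product vanish also at points at
  -- infinity. Summed over `i`, only the moment at `a` survives.
  have hrow : ∀ i, ∑ b, g b * (y i 0 ^ (1 + (e - (b.1 + b.2))) * y i 1 ^ (b.1 + (a 1 - b₀.1) : ℕ) *
      y i 2 ^ (b.2 + (a 2 - b₀.2) : ℕ)) = 0 := by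
    intro i
    by_cases hα : y i 0 = 0
    · refine Finset.sum_eq_zero fun b _ => ?_
      rw [hα, zero_pow (by omega)]
      simp
    · rw [← mul_zero (y i 0 ^ (1 + e) * y i 1 ^ (a 1 - b₀.1 : ℕ) * y i 2 ^ (a 2 - b₀.2 : ℕ)),
        ← hE i, Finset.mul_sum]
      refine Finset.sum_congr rfl fun b _ => ?_
      by_cases hgb : g b = 0
      · simp [hgb]
      · obtain ⟨f, hf⟩ := Nat.exists_eq_add_of_le (hmax b hgb)
        rw [hf, Nat.add_sub_cancel_left]
        simp only [pow_add, div_pow]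
        field_simp
  have hcol : ∑ b, g b * ∑ i, y i 0 ^ (1 + (e - (b.1 + b.2))) *
      y i 1 ^ (b.1 + (a 1 - b₀.1) : ℕ) * y i 2 ^ (b.2 + (a 2 - b₀.2) : ℕ) = 0 := by
    simp only [Finset.mul_sum]
    rw [Finset.sum_comm]
    exact Finset.sum_eq_zero fun i _ => hrow i
  rw [Finset.sum_eq_single b₀] at hcol
  · rw [← he, Nat.sub_self, add_zero, Nat.add_sub_cancel' (by omega),
      Nat.add_sub_cancel' (by omega)] at hcol
    exact (mul_ne_zero hb₀ hmom1) hcol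
  · intro b _ hb
    by_cases hgb : g b = 0
    · simp [hgb]
    · have := hmax b hgb
      rw [hmom _ _ _ (by omega), mul_zero]
      intro heq
      simp only [Prod.mk.injEq] at heq
      exact hb (Prod.ext (Fin.ext (by omega)) (Fin.ext (by omega)))
  · simp

end Monomials

/-! ### The maximum over monomials and the asymptotics. -/

section MaximalRank

/-- The maximal Waring rank of a ternary monomial of degree `d`, for `2 < d`. -/
def maxMonomialRank (d : ℕ) : ℕ := ((d - 1) / 2 + 1) * (d / 2 + 1)

theorem maxMonomialRank_odd (t : ℕ) : maxMonomialRank (2 * t + 1) = (t + 1) * (t + 1) := by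
  rw [maxMonomialRank, show (2 * t + 1 - 1) / 2 = t by omega, show (2 * t + 1) / 2 = t by omega]

theorem maxMonomialRank_even {t : ℕ} (ht : t ≠ 0) :
    maxMonomialRank (2 * t) = t * (t + 1) := by
  rw [maxMonomialRank, show (2 * t - 1) / 2 + 1 = t by omega, show 2 * t / 2 = t by omega]

/-- This disposes of monomials in at most two variables, and fails for `d = 2`. -/
theorem add_one_le_maxMonomialRank {d : ℕ} (hd : 2 < d) : d + 1 ≤ maxMonomialRank d := by
  rcases Nat.even_or_odd' d with ⟨t, rfl | rfl⟩
  · rw [maxMonomialRank_even (by omega)]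
    nlinarith [show 2 ≤ t by omega]
  · rw [maxMonomialRank_odd]
    nlinarith [show 1 ≤ t by omega]

theorem mul_le_maxMonomialRank {d b c : ℕ} (hd : 2 < d) (h : b + c + 1 ≤ d) :
    (b + 1) * (c + 1) ≤ maxMonomialRank d := by
  rcases Nat.even_or_odd' d with ⟨t, rfl | rfl⟩
  · rw [maxMonomialRank_even (by omega)]
    rcases Nat.lt_or_ge b t with hb | hb
    · obtain ⟨e, rfl⟩ := Nat.exists_eq_add_of_lt hb
      nlinarith [show c ≤ b + 2 * e + 1 by omega]
    · obtain ⟨e, rfl⟩ := Nat.exists_eq_add_of_le hb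
      obtain ⟨f, rfl⟩ : ∃ f, t = c + e + 1 + f := ⟨t - (c + e + 1), by omega⟩
      nlinarith
  · rw [maxMonomialRank_odd]
    nlinarith [sq_nonneg ((b : ℤ) - c), two_mul_le_add_sq b c]

theorem Nat.floor_sub_one_div_two {d : ℕ} (hd : 0 < d) :
    ⌊((d : ℚ) - 1) / 2⌋₊ = (d - 1) / 2 := by
  rw [← Nat.cast_pred hd]
  exact_mod_cast Nat.floor_div_eq_div (K := ℚ) (d - 1) 2

theorem Nat.ceil_sub_one_div_two {d : ℕ} (hd : 2 < d) :
    ⌈((d : ℚ) - 1) / 2⌉₊ = d / 2 := by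
  rw [Nat.ceil_eq_iff (by omega)]
  have h1 : d ≤ 2 * (d / 2) + 1 := by omega
  have h2 : 2 * (d / 2) ≤ d := by omega
  have h1' : (d : ℚ) ≤ 2 * (d / 2 : ℕ) + 1 := by exact_mod_cast h1
  have h2' : 2 * ((d / 2 : ℕ) : ℚ) ≤ d := by exact_mod_cast h2
  rw [Nat.cast_pred (by omega)]
  constructor <;> linarith

variable {k : Type*} [Field k] [IsAlgClosed k] [CharZero k]

theorem waringRank_monomial_le {d : ℕ} (hd : 2 < d) {a : Fin 3 →₀ ℕ} (ha : a.degree = d) :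
    waringRank d (MvPolynomial.monomial a (1 : k)) ≤ maxMonomialRank d := by
  subst ha
  have hmono := Tuple.monotone_sort a
  set σ := Tuple.sort a
  have h1 : a (σ 0) ≤ a (σ 1) := hmono (by decide)
  have h2 : a (σ 0) ≤ a (σ 2) := hmono (by decide)
  by_cases h0 : a (σ 0) = 0
  · exact (waringRank_le (isSumOfPowers_monomial_of_eq_zero a (by omega) σ h0)).trans
      (Nat.cast_le.2 (add_one_le_maxMonomialRank hd))
  · refine (waringRank_le (isSumOfPowers_monomial a (by omega) σ h1 h2)).trans
      (Nat.cast_le.2 (mul_le_maxMonomialRank hd ?_))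
    rw [Finsupp.degree_fin_three_perm σ a]
    omega

theorem waringRank_X_mul_X_pow_mul_X_pow {d : ℕ} (hd : 2 < d) :
    waringRank d (MvPolynomial.X 0 * MvPolynomial.X 1 ^ ((d - 1) / 2) *
      MvPolynomial.X 2 ^ (d / 2) : MvPolynomial (Fin 3) k) = maxMonomialRank d ∧
    (maxMonomialRank d : ℕ∞) ∈ ternaryMonomialRanks k d := by
  let a : Fin 3 →₀ ℕ := Finsupp.equivFunOnFinite.symm ![1, (d - 1) / 2, d / 2]
  have hX : (MvPolynomial.X 0 * MvPolynomial.X 1 ^ ((d - 1) / 2) *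
      MvPolynomial.X 2 ^ (d / 2) : MvPolynomial (Fin 3) k) = MvPolynomial.monomial a 1 := by
    rw [MvPolynomial.monomial_eq, Finsupp.prod_fintype _ _ (by simp), Fin.prod_univ_three]
    simp [a]
  have ha : a.degree = d := by
    rw [degree_fin_three]
    simp [a]
    omega
  have hrank : waringRank d (MvPolynomial.monomial a (1 : k)) = maxMonomialRank d := by
    refine le_antisymm (waringRank_monomial_le hd ha) (le_waringRank fun s hs => ?_)
    rw [← ha] at hs
    exact le_of_isSumOfPowers_monomial (by simp [a]) hs
  exact ⟨hX ▸ hrank, a, ha, hrank⟩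

theorem maxMonomialRank_isEquivalent :
    (fun d : ℕ => (maxMonomialRank d : ℝ)) ~[atTop]
      (fun d : ℕ => (3 / 2 : ℝ) * (⌈((d + 2).choose 2 : ℚ) / 3⌉₊ : ℝ)) := by
  have hm : ∀ d : ℕ, 2 < d → (d : ℝ) ^ 2 + 2 * d ≤ 4 * maxMonomialRank d ∧
      4 * (maxMonomialRank d : ℝ) ≤ d ^ 2 + 2 * d + 1 := by
    intro d hd
    rcases Nat.even_or_odd' d with ⟨t, rfl | rfl⟩
    · rw [maxMonomialRank_even (by omega)]
      push_cast
      constructor <;> nlinarith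
    · rw [maxMonomialRank_odd]
      push_cast
      constructor <;> nlinarith
  have hg : ∀ d : ℕ, (d : ℝ) ^ 2 + 3 * d + 2 ≤ 6 * ⌈((d + 2).choose 2 : ℚ) / 3⌉₊ ∧
      6 * (⌈((d + 2).choose 2 : ℚ) / 3⌉₊ : ℝ) ≤ d ^ 2 + 3 * d + 8 := by
    intro d
    have hN : (((d + 2).choose 2 : ℕ) : ℚ) = ((d : ℚ) ^ 2 + 3 * d + 2) / 2 := by
      rw [Nat.cast_choose_two]
      push_cast
      ring
    have h1 := Nat.le_ceil (((d + 2).choose 2 : ℚ) / 3)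
    have h2 := (Nat.ceil_lt_add_one (a := ((d + 2).choose 2 : ℚ) / 3) (by positivity)).le
    rw [hN] at h1 h2 ⊢
    have h1' : (d : ℚ) ^ 2 + 3 * d + 2 ≤ 6 * ⌈((d : ℚ) ^ 2 + 3 * d + 2) / 2 / 3⌉₊ := by linarith
    have h2' : 6 * (⌈((d : ℚ) ^ 2 + 3 * d + 2) / 2 / 3⌉₊ : ℚ) ≤ d ^ 2 + 3 * d + 8 := by linarith
    exact ⟨by exact_mod_cast h1', by exact_mod_cast h2'⟩
  -- By `hm` and `hg` the difference is `O(d)`, while the right-hand side dominates a multiple of `d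
  -- ^ 2`.
  refine IsLittleO.trans_isBigO (g := fun d : ℕ => (d : ℝ) ^ 2) ?_ ?_
  · refine IsBigO.trans_isLittleO (g := fun d : ℕ => (d : ℝ) ^ 1) ?_ ?_
    · refine IsBigO.of_bound 4 (eventually_atTop.2 ⟨3, fun d hd => ?_⟩)
      have h1 := hm d hd
      have h2 := hg d
      have h3 : (3 : ℝ) ≤ d := by exact_mod_cast hd
      rw [Pi.sub_apply, Real.norm_eq_abs, Real.norm_of_nonneg (by positivity), abs_le]
      constructor <;> linarith
    · exact (isLittleO_pow_pow_atTop_of_lt (by norm_num)).comp_tendsto tendsto_natCast_atTop_atTop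
  · refine IsBigO.of_bound 4 (Eventually.of_forall fun d => ?_)
    have h2 := hg d
    rw [Real.norm_of_nonneg (by positivity), Real.norm_of_nonneg (by positivity)]
    have h3 : (0 : ℝ) ≤ d := Nat.cast_nonneg d
    linarith

end MaximalRank

theorem proposition4p1 (k : Type*) [Field k] [IsAlgClosed k] [CharZero k] :
    ∃ m : ℕ → ℕ,
      -- the maximal rank of a monomial of degree `d` and its value
      (∀ d : ℕ, 2 < d → IsGreatest (ternaryMonomialRanks k d) (m d : ℕ∞)) ∧
      (∀ d : ℕ, 2 < d → Odd d → (m d : ℚ) = (((d : ℚ) + 1) / 2) ^ 2) ∧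
      (∀ d : ℕ, 2 < d → Even d → (m d : ℚ) = ((d : ℚ) / 2) * ((d : ℚ) / 2 + 1)) ∧
      -- it is attained by the monomial with exponents `1, ⌊(d-1)/2⌋, ⌈(d-1)/2⌉`
      (∀ d : ℕ, 2 < d →
        waringRank d (MvPolynomial.X 0 *
          MvPolynomial.X 1 ^ ⌊((d : ℚ) - 1) / 2⌋₊ *
          MvPolynomial.X 2 ^ ⌈((d : ℚ) - 1) / 2⌉₊ : MvPolynomial (Fin 3) k) = (m d : ℕ∞)) ∧
      -- the rank of the generic form of degree `d`
      (∀ d : ℕ, 2 < d → d ≠ 4 →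
        IsGenericTernaryRank k d ⌈((d + 2).choose 2 : ℚ) / 3⌉₊) ∧
      -- the asymptotic comparison
      (fun d : ℕ => (m d : ℝ)) ~[atTop]
        (fun d : ℕ => (3 / 2 : ℝ) * (⌈((d + 2).choose 2 : ℚ) / 3⌉₊ : ℝ)) := by
  refine ⟨maxMonomialRank, fun d hd => ⟨(waringRank_X_mul_X_pow_mul_X_pow hd).2, ?_⟩,
    fun d _ hodd => ?_, fun d hd heven => ?_, fun d hd => ?_,
    fun d hd hd4 => isGenericTernaryRank_ceil hd hd4, maxMonomialRank_isEquivalent⟩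
  · rintro _ ⟨a, ha, rfl⟩
    exact waringRank_monomial_le hd ha
  · obtain ⟨t, rfl⟩ := hodd
    rw [maxMonomialRank_odd]
    push_cast
    ring
  · obtain ⟨t, rfl⟩ := even_iff_exists_two_mul.1 heven
    rw [maxMonomialRank_even (by omega)]
    push_cast
    ring
  · rw [Nat.floor_sub_one_div_two (by omega), Nat.ceil_sub_one_div_two hd]
    exact (waringRank_X_mul_X_pow_mul_X_pow hd).1
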